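/- Let $k$ be a field, let $G$ be a finite simple graph on $r$ vertices with no isolated vertex, let $R=k[x_v : v\in V(G)]$, and let $J=J(G)=\bigcap_{\{u,v\}\in E(G)}(x_u,x_v)$ be the cover ideal of $G$. For an ideal $I$ of $R$ and $n\ge 0$, let $I^{(n)}=\bigcap_{\mathfrak p}(I^nR_{\mathfrak p}\cap R)$, where $\mathfrak p$ runs over the minimal primes of $I$. For a monomial ideal $I$, let $\mathcal G(I)$ be its set of minimal monomial generators and, for $I\neq 0$, let $d(I)$ be the maximal degree of a minimal homogeneous generator of $I$. Let $\mathrm{SP}(J)\subseteq\mathbb R^{V(G)}$ be the symbolic polyhedron of $J$, i.e. the intersection of the Newton polyhedra $NP(JR_{\mathfrak p}\cap R)$ over the minimal primes $\mathfrak p$ of $J$, where $NP(Q)$ is the convex hull of the exponent vectors of all monomials in $Q$. Let $\delta(J)$ be the maximum of the coordinate sums $|\mathbf v|$ over the vertices $\mathbf v$ of $\mathrm{SP}(J)$. (All these maxima exist.) 1. $d(J^{(2s)})=2s\,\delta(J)$ for every $s\ge 1$. 2. There exists $m_2\in\mathcal G(J)$ such that $m_1m_2\in\mathcal G(J^{(3)})$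 for some $m_1\in\mathcal G(J^{(2)})$ with $\deg m_1=2\delta(J)$. Let $e$ be the maximal degree of such an $m_2$. Then $d(J^{(2s+1)})=2s\,\delta(J)+e$ for every integer $s\ge 0$ with $s\ge d(J)-e$. 3. If $\delta(J)=d(J)$ or $\delta(J)=r/2$, then $e=d(J)$. In particular, in this case $d(J^{(2s+1)})=2s\,\delta(J)+d(J)$ for all $s\ge 0$. -/

import Mathlib

noncomputable section

/-- The contraction `I R_P ∩ R` of the extension of `I` to the localization at the prime `P`.
If `P` is a minimal prime of `I`, this is the `P`-primary component of `I`, that is, the unique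
`P`-primary ideal that occurs in a minimal primary decomposition of `I`. -/
def localContraction {R : Type*} [CommRing R] (I P : Ideal R) [P.IsPrime] : Ideal R :=
  (I.map (algebraMap R (Localization.AtPrime P))).comap (algebraMap R (Localization.AtPrime P))

/-- Minimal primes are prime. -/
theorem isPrime_of_minimalPrimes {R : Type*} [CommRing R] {I : Ideal R} (P : I.minimalPrimes) :
    (P : Ideal R).IsPrime :=
  P.2.1.1

/-- The `n`-th symbolic power `I^(n) = ⋂ (I ^ n R_P ∩ R)`, where `P` runs over the minimal primes
of `I`. -/
def symbolicPower {R : Type*} [CommRing R] (I : Ideal R) (n : ℕ) : Ideal R :=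
  ⨅ P : I.minimalPrimes,
    haveI := isPrime_of_minimalPrimes P
    localContraction (I ^ n) (P : Ideal R)

/-- The cover ideal `J(G) = ⋂ (x_u, x_v)` of the graph `G`, where `uv` runs over the edges. -/
def coverIdeal (k : Type*) [Field k] {V : Type*} (G : SimpleGraph V) : Ideal (MvPolynomial V k) :=
  ⨅ (u : V) (v : V) (_ : G.Adj u v), Ideal.span {MvPolynomial.X u, MvPolynomial.X v}

/-- The exponents `α` of the minimal monomial generators `x ^ α` of an ideal `I`: the monomials of
`I` that are minimal for divisibility. -/
def minimalGens {k : Type*} [Field k] {V : Type*} (I : Ideal (MvPolynomial V k)) :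
    Set (V →₀ ℕ) :=
  {α | Minimal (fun β : V →₀ ℕ => MvPolynomial.monomial β (1 : k) ∈ I) α}

/-- The degrees of the minimal homogeneous generators of `I`, that is, the degrees of the
homogeneous elements of `I` that do not lie in `𝔪 I`, where `𝔪` is the ideal generated by the
variables; equivalently, the degrees in which `I / 𝔪 I = Tor₀(k, I)` is nonzero. -/
def genDegrees {k : Type*} [Field k] {V : Type*} (I : Ideal (MvPolynomial V k)) : Set ℕ :=
  {j | ∃ f ∈ I, f.IsHomogeneous j ∧
    f ∉ Ideal.span (Set.range (MvPolynomial.X : V → MvPolynomial V k)) * I}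

/-- `d(I)`, the maximal degree of a minimal homogeneous generator of `I`. -/
def maxGenDegree {k : Type*} [Field k] {V : Type*} (I : Ideal (MvPolynomial V k)) : ℕ :=
  sSup (genDegrees I)

/-- The Newton polyhedron of `I`: the convex hull of the exponents of the monomials in `I`. -/
def newtonPolyhedron {k : Type*} [Field k] {V : Type*} (I : Ideal (MvPolynomial V k)) :
    Set (V → ℝ) :=
  convexHull ℝ
    {x | ∃ α : V →₀ ℕ, MvPolynomial.monomial α (1 : k) ∈ I ∧ ∀ v, x v = (α v : ℝ)}

/-- The symbolic polyhedron of `I`: the intersection of the Newton polyhedra of the primary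
components of `I` at its minimal primes. -/
def symbolicPolyhedron {k : Type*} [Field k] {V : Type*} (I : Ideal (MvPolynomial V k)) :
    Set (V → ℝ) :=
  ⋂ P : I.minimalPrimes,
    haveI := isPrime_of_minimalPrimes P
    newtonPolyhedron (localContraction I (P : Ideal (MvPolynomial V k)))

/-- The coordinate sums `|v|` of the vertices `v` (the extreme points) of the symbolic
polyhedron of `I`. -/
def vertexSums {k : Type*} [Field k] {V : Type*} [Fintype V] (I : Ideal (MvPolynomial V k)) :
    Set ℝ :=
  (fun x : V → ℝ => ∑ v, x v) '' (symbolicPolyhedron I).extremePoints ℝ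

/-- `δ(I)`, the maximal coordinate sum of a vertex of the symbolic polyhedron of `I`. -/
def delta {k : Type*} [Field k] {V : Type*} [Fintype V] (I : Ideal (MvPolynomial V k)) : ℝ :=
  sSup (vertexSums I)

/-- The degrees of the `m₂ ∈ 𝒢(I)` such that `m₁ m₂ ∈ 𝒢(I^(3))` for some `m₁ ∈ 𝒢(I^(2))` of degree
`2 δ(I)`. Monomials are given by their exponents, so that the product is a sum. -/
def complementaryDegrees {k : Type*} [Field k] {V : Type*} [Fintype V]
    (I : Ideal (MvPolynomial V k)) : Set ℕ :=
  {e | ∃ m₂ ∈ minimalGens I, m₂.degree = e ∧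
    ∃ m₁ ∈ minimalGens (symbolicPower I 2), (m₁.degree : ℝ) = 2 * delta I ∧
      m₁ + m₂ ∈ minimalGens (symbolicPower I 3)}

end

/-! At the prime `(x_u, x_v)` of an edge, `J` localizes to that prime, and the powers of the prime
are primary. So `x ^ α` lies in `J^(n)` exactly when `α u + α v ≥ n` on every edge, and the minimal
generators of `J^(n)` are the minimal `n`-covers. A cover is minimal when each vertex of its support
lies on a tight edge (`minimal_isMultiCover_iff`), and an edge tight for a sum is tight for the
summands.

A minimal `n + 2`-cover splits off a minimal `2`-cover (`exists_add_of_minimal_isMultiCover`).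
Repeated splitting bounds degrees from above; repeating a `2`-cover of maximal degree gives the
lower bounds. In the odd case `2s + 1`, splitting leaves one `1`-cover. Either one of the `s`
split-off `2`-covers has maximal degree, so that the `1`-cover has degree at most `e`, or each of
them loses at least one degree, which makes up for `d(J) - e` once `s ≥ d(J) - e`.

Finally `2 δ(J) = d(J^(2))`: vertices of the polyhedron of fractional covers are half-integral and
double to minimal `2`-covers, and the face through half a minimal `2`-cover contains a vertex with
at least the same coordinate sum. -/

namespace SimpleGraph

/-! ### Combinatorics of minimal multicovers -/

variable {V : Type*} {G : SimpleGraph V} {m n : ℕ} {α β : V →₀ ℕ}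

/-- `α` is an `n`-cover of `G` if `α u + α v ≥ n` for every edge `uv`. -/
def IsMultiCover (G : SimpleGraph V) (n : ℕ) (α : V →₀ ℕ) : Prop :=
  ∀ u v, G.Adj u v → n ≤ α u + α v

theorem IsMultiCover.add (h : G.IsMultiCover m α) (h' : G.IsMultiCover n β) :
    G.IsMultiCover (m + n) (α + β) := fun u v huv => by
  have := h u v huv
  have := h' u v huv
  simp only [Finsupp.add_apply]
  omega

/-- A cover is minimal if and only if every vertex of its support lies on a tight edge. -/
theorem minimal_isMultiCover_iff :
    Minimal (G.IsMultiCover n) α ↔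
      G.IsMultiCover n α ∧ ∀ v, α v ≠ 0 → ∃ u, G.Adj v u ∧ α v + α u = n := by
  classical
  refine ⟨fun h => ⟨h.prop, fun v hv => ?_⟩, fun ⟨h, ht⟩ => ⟨h, fun β hβ hle v => ?_⟩⟩
  · by_contra! hcon
    have hc : G.IsMultiCover n (α - Finsupp.single v 1) := by
      intro a b hab
      have h1 := h.prop a b hab
      simp only [Finsupp.tsub_apply]
      have key : ∀ b, G.Adj v b → n + 1 ≤ α v + α b := fun b hb => by
        have := h.prop v b hb
        have := hcon b hb
        omega
      by_cases hav : a = v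
      · subst hav
        have := key b hab
        rw [Finsupp.single_eq_same, Finsupp.single_eq_of_ne hab.ne']
        omega
      · rw [Finsupp.single_eq_of_ne hav]
        by_cases hbv : b = v
        · subst hbv
          have := key a hab.symm
          rw [Finsupp.single_eq_same]
          omega
        · rw [Finsupp.single_eq_of_ne hbv]
          omega
    have := h.le_of_le hc tsub_le_self v
    simp only [Finsupp.tsub_apply, Finsupp.single_eq_same] at this
    omega
  · by_cases hv : α v = 0
    · simp [hv]
    · obtain ⟨u, hu, he⟩ := ht v hv
      have h1 := hβ v u hu
      have h2 : β u ≤ α u := hle u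
      change α v ≤ β v
      omega

/-- The inequalities for `α` and `β` add up to the one for `α + β`, so an edge tight for the sum is
tight for both summands. -/
theorem minimal_isMultiCover_of_add (hα : G.IsMultiCover m α) (hβ : G.IsMultiCover n β)
    (h : Minimal (G.IsMultiCover (m + n)) (α + β)) : Minimal (G.IsMultiCover m) α := by
  refine minimal_isMultiCover_iff.2 ⟨hα, fun v hv => ?_⟩
  obtain ⟨u, hu, he⟩ := (minimal_isMultiCover_iff.1 h).2 v (by simp [hv])
  refine ⟨u, hu, ?_⟩
  have h1 := hα v u hu
  have h2 := hβ v u hu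
  simp only [Finsupp.add_apply] at he
  omega

/-- Edges tight for `α + β` are tight for `α` and for `β`, hence for every combination. At `s = 0`
the support of `α` plays no role, and the tight edges come from `h0`. -/
theorem minimal_isMultiCover_nsmul_add (s : ℕ)
    (hα : G.IsMultiCover m α) (hβ : G.IsMultiCover n β)
    (h : Minimal (G.IsMultiCover (m + n)) (α + β)) (h0 : Minimal (G.IsMultiCover n) β) :
    Minimal (G.IsMultiCover (s * m + n)) (s • α + β) := by
  refine minimal_isMultiCover_iff.2 ⟨fun u v huv => ?_, fun v hv => ?_⟩
  · have h1 := Nat.mul_le_mul_left s (hα u v huv)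
    have h2 := hβ u v huv
    simp only [Finsupp.add_apply, Finsupp.smul_apply, smul_eq_mul]
    rw [mul_add] at h1
    omega
  · have : ∃ u, G.Adj v u ∧ α v + α u = m ∧ β v + β u = n ∨
        s = 0 ∧ G.Adj v u ∧ β v + β u = n := by
      by_cases hs : s = 0
      · obtain ⟨u, hu, he⟩ := (minimal_isMultiCover_iff.1 h0).2 v (by simpa [hs] using hv)
        exact ⟨u, Or.inr ⟨hs, hu, he⟩⟩
      · have hv' : (α + β) v ≠ 0 := by
          intro hc
          simp only [Finsupp.add_apply, Nat.add_eq_zero_iff] at hc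
          simp [hc] at hv
        obtain ⟨u, hu, he⟩ := (minimal_isMultiCover_iff.1 h).2 v hv'
        have h1 := hα v u hu
        have h2 := hβ v u hu
        simp only [Finsupp.add_apply] at he
        exact ⟨u, Or.inl ⟨hu, by omega, by omega⟩⟩
    obtain ⟨u, ⟨hu, h1, h2⟩ | ⟨rfl, hu, h2⟩⟩ := this
    · refine ⟨u, hu, ?_⟩
      simp only [Finsupp.add_apply, Finsupp.smul_apply, smul_eq_mul]
      rw [← h1, mul_add]
      omega
    · exact ⟨u, hu, by simpa using h2⟩

theorem minimal_isMultiCover_zero : Minimal (G.IsMultiCover 0) (0 : V →₀ ℕ) :=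
  minimal_isMultiCover_iff.2 ⟨fun _ _ _ => Nat.zero_le _, fun _ h => absurd rfl h⟩

theorem minimal_isMultiCover_zero_iff : Minimal (G.IsMultiCover 0) α ↔ α = 0 :=
  ⟨fun h => le_antisymm (h.le_of_le minimal_isMultiCover_zero.prop zero_le) zero_le,
    fun h => h ▸ minimal_isMultiCover_zero⟩

theorem le_of_minimal_isMultiCover (h : Minimal (G.IsMultiCover n) α) (v : V) : α v ≤ n := by
  by_cases hv : α v = 0
  · omega
  · obtain ⟨u, -, he⟩ := (minimal_isMultiCover_iff.1 h).2 v hv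
    omega

/-- A minimal `n + 2`-cover splits off a minimal `2`-cover. -/
theorem exists_add_of_minimal_isMultiCover (h : Minimal (G.IsMultiCover (n + 2)) α) :
    ∃ β γ, Minimal (G.IsMultiCover 2) β ∧ Minimal (G.IsMultiCover n) γ ∧ α = β + γ := by
  classical
  -- A neighbour of a vertex of value `0` has value at least `n + 2`, so it must give `2` to `β` and
  -- can spare it. On an edge with two positive ends, `1` from each end suffices.
  let β : V →₀ ℕ := α.mapRange (fun a => if a = 0 then 0 else if a ≤ n + 1 then 1 else 2) (by simp)
  have hβv : ∀ v, β v = if α v = 0 then 0 else if α v ≤ n + 1 then 1 else 2 := fun v => rfl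
  have hadd : α = β + (α - β) := by
    ext v
    have := hβv v
    simp only [Finsupp.add_apply, Finsupp.tsub_apply]
    split_ifs at this <;> omega
  have h1 : G.IsMultiCover 2 β := fun u v huv => by
    have h1 := h.prop u v huv
    rw [hβv, hβv]
    split_ifs <;> omega
  have h2 : G.IsMultiCover n (α - β) := fun u v huv => by
    have h1 := h.prop u v huv
    simp only [Finsupp.tsub_apply]
    rw [hβv, hβv]
    split_ifs <;> omega
  refine ⟨β, α - β, ?_, ?_, hadd⟩
  · exact minimal_isMultiCover_of_add h1 h2 (by rwa [← hadd, add_comm])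
  · exact minimal_isMultiCover_of_add h2 h1 (by rwa [add_comm (α - β), ← hadd])

theorem degree_le_of_minimal_isMultiCover_even {d : ℕ}
    (hd : ∀ β, Minimal (G.IsMultiCover 2) β → β.degree ≤ d) (s : ℕ) {α : V →₀ ℕ}
    (h : Minimal (G.IsMultiCover (2 * s)) α) : α.degree ≤ s * d := by
  induction s generalizing α with
  | zero => simp [minimal_isMultiCover_zero_iff.1 h]
  | succ s ih =>
    obtain ⟨β, γ, hβ, hγ, rfl⟩ := exists_add_of_minimal_isMultiCover h
    rw [map_add, add_mul, one_mul, add_comm]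
    exact add_le_add (ih hγ) (hd β hβ)

/-- A minimal odd cover is the sum of minimal `2`-covers, and a minimal cover of `G`, so it either
contains a minimal `3`-cover with a summand of degree `d` or its degree is small. -/
theorem degree_le_of_minimal_isMultiCover_odd {d d₁ e : ℕ}
    (hd : ∀ β, Minimal (G.IsMultiCover 2) β → β.degree ≤ d)
    (hd₁ : ∀ β, Minimal (G.IsMultiCover 1) β → β.degree ≤ d₁)
    (he : ∀ β γ, Minimal (G.IsMultiCover 2) β → Minimal (G.IsMultiCover 1) γ →
      Minimal (G.IsMultiCover 3) (β + γ) → β.degree = d → γ.degree ≤ e)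
    (s : ℕ) {α : V →₀ ℕ} (h : Minimal (G.IsMultiCover (2 * s + 1)) α) :
    α.degree ≤ s * d + e ∨ α.degree + s ≤ s * d + d₁ := by
  -- The `1`-cover `γ` stays fixed while `2`-covers are added to `δ`. The second alternative records
  -- a loss of at least one degree per added `2`-cover; the first one such cover of degree `d`
  -- bounds `γ` by `e`, since its sum with `γ` is a summand of a minimal cover.
  have key : ∃ γ δ, Minimal (G.IsMultiCover 1) γ ∧ Minimal (G.IsMultiCover (2 * s)) δ ∧
      α = γ + δ ∧ (γ.degree ≤ e ∨ δ.degree + s ≤ s * d) := by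
    clear hd₁
    induction s generalizing α with
    | zero =>
      exact ⟨α, 0, h, minimal_isMultiCover_zero, by simp, Or.inr (by simp)⟩
    | succ s ih =>
      have h' : Minimal (G.IsMultiCover (2 * s + 1 + 2)) α := h
      obtain ⟨β, ε, hβ, hε, rfl⟩ := exists_add_of_minimal_isMultiCover h'
      obtain ⟨γ, δ, hγ, hδ, rfl, hor⟩ := ih hε
      have hmin : Minimal (G.IsMultiCover (2 * (s + 1))) (β + δ) := by
        refine minimal_isMultiCover_of_add (n := 1) (β := γ) ?_ hγ.prop ?_
        · have := hβ.prop.add hδ.prop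
          rwa [show 2 + 2 * s = 2 * (s + 1) by ring] at this
        · rwa [show β + δ + γ = β + (γ + δ) by abel]
      refine ⟨γ, β + δ, hγ, hmin, by abel, ?_⟩
      rcases hor with hor | hor
      · exact Or.inl hor
      · rcases (hd β hβ).eq_or_lt with hdeg | hdeg
        · refine Or.inl (he β γ hβ hγ ?_ hdeg)
          refine minimal_isMultiCover_of_add (n := 2 * s) (β := δ) (hβ.prop.add hγ.prop) hδ.prop ?_
          rwa [show β + γ + δ = β + (γ + δ) by abel, show 2 + 1 + 2 * s = 2 * s + 1 + 2 by ring]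
        · right
          rw [map_add, add_mul]
          omega
  obtain ⟨γ, δ, hγ, hδ, rfl, hor⟩ := key
  have h1 := degree_le_of_minimal_isMultiCover_even hd s hδ
  have h2 := hd₁ γ hγ
  rw [map_add]
  omega

section Finite

variable [Finite V]

theorem finite_minimal_isMultiCover (G : SimpleGraph V) (n : ℕ) :
    {α | Minimal (G.IsMultiCover n) α}.Finite := by
  classical
  have := Fintype.ofFinite V
  refine (Set.finite_Iic (Finsupp.equivFunOnFinite.symm fun _ : V => n)).subset fun α hα v => ?_
  simpa using le_of_minimal_isMultiCover hα v

theorem exists_minimal_isMultiCover_le (h : G.IsMultiCover n α) :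
    ∃ β ≤ α, Minimal (G.IsMultiCover n) β := by
  classical
  have := Fintype.ofFinite V
  have hfin : {β : V →₀ ℕ | β ≤ α ∧ G.IsMultiCover n β}.Finite :=
    (Set.finite_Iic α).subset fun β hβ => hβ.1
  obtain ⟨β, hβ⟩ := hfin.exists_minimal ⟨α, le_rfl, h⟩
  exact ⟨β, hβ.prop.1, hβ.prop.2, fun γ hγ hle => hβ.le_of_le ⟨hle.trans hβ.prop.1, hγ⟩ hle⟩

theorem exists_minimal_isMultiCover (G : SimpleGraph V) (n : ℕ) :
    ∃ α, Minimal (G.IsMultiCover n) α := by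
  have := Fintype.ofFinite V
  have h : G.IsMultiCover n (Finsupp.equivFunOnFinite.symm fun _ : V => n) :=
    fun u v _ => by simp
  obtain ⟨β, -, hβ⟩ := exists_minimal_isMultiCover_le h
  exact ⟨β, hβ⟩

/-- Every minimal `2`-cover can be completed to a minimal `3`-cover by a minimal cover. -/
theorem exists_minimal_add_of_minimal_two (hα : Minimal (G.IsMultiCover 2) α) :
    ∃ β, Minimal (G.IsMultiCover 1) β ∧ Minimal (G.IsMultiCover 3) (α + β) := by
  classical
  obtain ⟨hc, ht⟩ := minimal_isMultiCover_iff.1 hα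
  -- A minimal cover of the graph that `G` induces on the vertices of value one.
  let H : SimpleGraph V :=
    { Adj := fun u v => G.Adj u v ∧ α u = 1 ∧ α v = 1
      symm := ⟨fun u v h => ⟨h.1.symm, h.2.2, h.2.1⟩⟩
      loopless := ⟨fun u h => G.loopless.irrefl u h.1⟩ }
  obtain ⟨γ, hγ⟩ := exists_minimal_isMultiCover H 1
  obtain ⟨hγc, hγt⟩ := minimal_isMultiCover_iff.1 hγ
  have hγ1 : ∀ v, γ v ≠ 0 → α v = 1 := fun v hv => by
    obtain ⟨u, hu, -⟩ := hγt v hv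
    exact hu.2.1
  have hα2 := le_of_minimal_isMultiCover hα
  -- As `α ≤ 2`, the term `α / 2` is the indicator of the value `2`. An edge whose ends are not both
  -- of value `1` has an end of value `2`.
  let β : V →₀ ℕ := γ + α.mapRange (fun a => a / 2) (by simp)
  have hβv : ∀ v, β v = γ v + α v / 2 := fun v => rfl
  have hβ : G.IsMultiCover 1 β := fun u v huv => by
    rw [hβv, hβv]
    have h2 := hc u v huv
    by_cases h1 : α u = 1 ∧ α v = 1
    · have := hγc u v ⟨huv, h1⟩
      omega
    · have := hα2 u
      have := hα2 v
      omega
  have hmin : Minimal (G.IsMultiCover 3) (α + β) := by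
    refine minimal_isMultiCover_iff.2 ⟨hc.add hβ, fun v hv => ?_⟩
    simp only [Finsupp.add_apply, hβv] at hv ⊢
    have hv2 := hα2 v
    have hv0 : α v ≠ 0 := fun h0 => by
      have := hγ1 v (by omega)
      omega
    obtain ⟨u, hu, he⟩ := ht v hv0
    have hzero : ∀ w, α w ≠ 1 → γ w = 0 := fun w hw => by
      by_contra h
      exact hw (hγ1 w h)
    -- At value `1`, a tight edge of `α` if `γ v = 0`, and a tight edge of `γ` in `H` otherwise,
    -- joins two vertices of value `1`. At value `2`, the tight neighbour has value `0`, where `β`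
    -- vanishes.
    by_cases hv1 : α v = 1
    · by_cases hγv : γ v = 0
      · refine ⟨u, hu, ?_⟩
        have hu1 : α u = 1 := by omega
        have h3 := hγc v u ⟨hu, hv1, hu1⟩
        have h4 := le_of_minimal_isMultiCover hγ u
        omega
      · obtain ⟨w, hw, hwe⟩ := hγt v hγv
        have := hw.2.2
        exact ⟨w, hw.1, by omega⟩
    · refine ⟨u, hu, ?_⟩
      have h3 := hzero v hv1
      have h4 := hzero u (by omega)
      omega
  refine ⟨β, minimal_isMultiCover_of_add hβ hc ?_, hmin⟩
  rwa [add_comm β]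

end Finite

end SimpleGraph

noncomputable section

open MvPolynomial
open scoped Pointwise

/-! ### The primes generated by two variables, and their powers -/

section MonomialPrimes

variable {k : Type*} [Field k] {V : Type*} {u v : V} {n : ℕ}

/-- The weight on exponents that sums the entries at `u` and `v`. -/
def pairWeight (u v : V) : V → ℕ :=
  open Classical in fun i => if i = u ∨ i = v then 1 else 0

theorem weight_pairWeight (huv : u ≠ v) (α : V →₀ ℕ) :
    Finsupp.weight (pairWeight u v) α = α u + α v := by
  classical
  induction α using Finsupp.induction_linear with
  | zero => simp
  | add f g hf hg => simp only [map_add, hf, hg, Finsupp.add_apply]; ring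
  | single a b =>
    simp only [Finsupp.weight_single, pairWeight, Finsupp.single_apply]
    by_cases h1 : a = u
    · subst h1; simp [huv]
    · by_cases h2 : a = v
      · subst h2; simp [h1]
      · simp [h1, h2]

/-- The weighted order of power series over a field is additive on products; this gives both the
description of the powers of the prime and the cancellation below. -/
theorem le_weightedOrder_coe_iff (huv : u ≠ v) {f : MvPolynomial V k} :
    (n : ℕ∞) ≤ (f : MvPowerSeries V k).weightedOrder (pairWeight u v) ↔
      ∀ α ∈ f.support, n ≤ α u + α v := by
  refine ⟨fun h α hα => ?_, fun h => MvPowerSeries.nat_le_weightedOrder _ fun α hα => ?_⟩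
  · rw [← weight_pairWeight huv]
    have h1 := MvPowerSeries.weightedOrder_le (pairWeight u v) (f := (f : MvPowerSeries V k))
      (d := α) (by simpa using hα)
    exact_mod_cast h.trans h1
  · rw [weight_pairWeight huv] at hα
    rw [MvPolynomial.coeff_coe]
    by_contra hc
    exact absurd (h α (mem_support_iff.2 hc)) (by omega)

theorem mem_span_pair_iff {f : MvPolynomial V k} :
    f ∈ Ideal.span {(X u : MvPolynomial V k), X v} ↔ ∀ α ∈ f.support, 1 ≤ α u + α v := by
  rw [← Set.image_pair, mem_ideal_span_X_image]
  refine forall₂_congr fun α _ => ?_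
  simp only [Set.mem_insert_iff, Set.mem_singleton_iff, exists_eq_or_imp, exists_eq_left]
  omega

theorem mem_span_pair_pow_iff (huv : u ≠ v) {f : MvPolynomial V k} :
    f ∈ Ideal.span {(X u : MvPolynomial V k), X v} ^ n ↔ ∀ α ∈ f.support, n ≤ α u + α v := by
  refine ⟨fun h => ?_, fun h => ?_⟩
  · rw [← le_weightedOrder_coe_iff huv]
    induction n generalizing f with
    | zero => simp
    | succ n ih =>
      rw [pow_succ] at h
      refine Submodule.mul_induction_on h (fun a ha b hb => ?_) fun a b ha hb => ?_
      · rw [coe_mul, MvPowerSeries.weightedOrder_mul]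
        have := (le_weightedOrder_coe_iff (n := 1) huv).2 (mem_span_pair_iff.1 hb)
        push_cast at this ⊢
        exact add_le_add (ih ha) this
      · rw [coe_add]
        exact (le_min ha hb).trans (MvPowerSeries.min_weightedOrder_le_add _)
  · rw [f.as_sum]
    refine Ideal.sum_mem _ fun α hα => Ideal.pow_le_pow_right (h α hα) ?_
    have hle : Finsupp.single u (α u) + Finsupp.single v (α v) ≤ α := by
      classical
      intro i
      simp only [Finsupp.add_apply, Finsupp.single_apply]
      by_cases h1 : u = i
      · subst h1; simp [huv.symm]
      · by_cases h2 : v = i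
        · subst h2; simp [h1]
        · simp [h1, h2]
    have he : monomial α (coeff α f) =
        X u ^ α u * X v ^ α v * monomial
          (α - (Finsupp.single u (α u) + Finsupp.single v (α v))) (coeff α f) := by
      rw [X_pow_eq_monomial, X_pow_eq_monomial, monomial_mul, monomial_mul, one_mul, one_mul,
        add_tsub_cancel_of_le hle]
    rw [he]
    refine Ideal.mul_mem_right _ _ ?_
    rw [pow_add]
    exact Ideal.mul_mem_mul (Ideal.pow_mem_pow (Ideal.subset_span (by simp)) _)
      (Ideal.pow_mem_pow (Ideal.subset_span (by simp)) _)

/-- A polynomial outside the prime has weighted order zero, so multiplying by it does not change the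
order. In effect, the powers of the prime are primary. -/
theorem le_of_mul_of_notMem_span_pair (huv : u ≠ v) {s f : MvPolynomial V k}
    (hs : s ∉ Ideal.span {(X u : MvPolynomial V k), X v})
    (h : ∀ α ∈ (s * f).support, n ≤ α u + α v) : ∀ α ∈ f.support, n ≤ α u + α v := by
  rw [← le_weightedOrder_coe_iff huv] at h ⊢
  have h0 : (s : MvPowerSeries V k).weightedOrder (pairWeight u v) = 0 := by
    rw [mem_span_pair_iff, ← le_weightedOrder_coe_iff huv, Nat.cast_one,
      Order.one_le_iff_ne_zero, not_not] at hs
    exact hs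
  rwa [coe_mul, MvPowerSeries.weightedOrder_mul, h0, zero_add] at h

theorem isPrime_span_pair (huv : u ≠ v) :
    (Ideal.span {(X u : MvPolynomial V k), X v}).IsPrime := by
  refine ⟨fun h => ?_, fun {a b} hab => ?_⟩
  · have := mem_span_pair_iff.1 ((Ideal.eq_top_iff_one _).1 h) 0 (by simp)
    simp at this
  · by_contra! hc
    exact hc.2 (mem_span_pair_iff.2
      (le_of_mul_of_notMem_span_pair huv hc.1 (mem_span_pair_iff.1 hab)))

theorem X_mem_span_pair_iff {a : V} :
    (X a : MvPolynomial V k) ∈ Ideal.span {(X u : MvPolynomial V k), X v} ↔ a = u ∨ a = v := by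
  classical
  rw [mem_span_pair_iff]
  simp only [X, support_monomial, one_ne_zero, if_false, Finset.mem_singleton, forall_eq,
    Finsupp.single_apply]
  by_cases h1 : a = u <;> by_cases h2 : a = v <;> simp [h1, h2]

end MonomialPrimes

/-! ### Minimal primes and symbolic powers of the cover ideal -/

section CoverIdeal

variable (k : Type*) [Field k] {V : Type*} (G : SimpleGraph V)

variable {k G} in
theorem mem_coverIdeal_iff {f : MvPolynomial V k} :
    f ∈ coverIdeal k G ↔ ∀ α ∈ f.support, G.IsMultiCover 1 α := by
  simp only [coverIdeal, Ideal.mem_iInf, mem_span_pair_iff, SimpleGraph.IsMultiCover]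
  exact ⟨fun h α hα u v huv => h u v huv α hα, fun h u v huv α hα => h α hα u v huv⟩

variable {k G} in
theorem coverIdeal_le_span_pair {u v : V} (huv : G.Adj u v) :
    coverIdeal k G ≤ Ideal.span {X u, X v} :=
  iInf_le_of_le u (iInf₂_le v huv)

variable [Fintype V]

variable {k G} in
theorem exists_span_pair_le_of_isPrime {P : Ideal (MvPolynomial V k)} (hP : P.IsPrime)
    (h : coverIdeal k G ≤ P) : ∃ u v, G.Adj u v ∧ Ideal.span {X u, X v} ≤ P := by
  classical
  have he : coverIdeal k G = (Finset.univ.filter fun p : V × V => G.Adj p.1 p.2).inf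
      fun p => Ideal.span {(X p.1 : MvPolynomial V k), X p.2} := by
    simp only [coverIdeal, Finset.inf_eq_iInf, Finset.mem_filter, Finset.mem_univ, true_and,
      iInf_prod]
  rw [he, hP.inf_le'] at h
  obtain ⟨p, hp, hle⟩ := h
  exact ⟨p.1, p.2, (Finset.mem_filter.1 hp).2, hle⟩

/-- A prime over `J` contains an edge prime, and edge primes are pairwise incomparable: if the ends
of one edge lie among those of another, the edges agree. -/
theorem mem_minimalPrimes_coverIdeal_iff {P : Ideal (MvPolynomial V k)} :
    P ∈ (coverIdeal k G).minimalPrimes ↔ ∃ u v, G.Adj u v ∧ P = Ideal.span {X u, X v} := by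
  refine ⟨fun h => ?_, ?_⟩
  · obtain ⟨u, v, huv, hle⟩ := exists_span_pair_le_of_isPrime h.1.1 h.1.2
    exact ⟨u, v, huv,
      le_antisymm (h.2 ⟨isPrime_span_pair huv.ne, coverIdeal_le_span_pair huv⟩ hle) hle⟩
  · rintro ⟨u, v, huv, rfl⟩
    refine ⟨⟨isPrime_span_pair huv.ne, coverIdeal_le_span_pair huv⟩, fun Q hQ hle => ?_⟩
    obtain ⟨a, b, hab, hle'⟩ := exists_span_pair_le_of_isPrime hQ.1 hQ.2
    have ha := X_mem_span_pair_iff.1 (hle (hle' (Ideal.subset_span (Set.mem_insert _ _))))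
    have hb := X_mem_span_pair_iff.1
      (hle (hle' (Ideal.subset_span (Set.mem_insert_of_mem _ rfl))))
    have hne := hab.ne
    rcases ha with rfl | rfl <;> rcases hb with rfl | rfl
    · exact absurd rfl hne
    · exact hle'
    · rwa [Set.pair_comm]
    · exact absurd rfl hne

theorem mem_localContraction_coverIdeal_pow_iff {u v : V} (huv : G.Adj u v) (n : ℕ)
    (P : Ideal (MvPolynomial V k)) [P.IsPrime] (hP : P = Ideal.span {X u, X v})
    {f : MvPolynomial V k} :
    f ∈ localContraction (coverIdeal k G ^ n) P ↔ ∀ α ∈ f.support, n ≤ α u + α v := by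
  classical
  rw [localContraction, Ideal.mem_comap,
    IsLocalization.algebraMap_mem_map_algebraMap_iff P.primeCompl]
  refine ⟨fun ⟨s, hs, hsf⟩ => ?_, fun h => ?_⟩
  · refine le_of_mul_of_notMem_span_pair huv.ne (hP ▸ hs)
      ((mem_span_pair_pow_iff huv.ne).1 (Ideal.pow_right_mono (coverIdeal_le_span_pair huv) n hsf))
  · let y : MvPolynomial V k := ∏ w ∈ Finset.univ.filter fun w => w ≠ u ∧ w ≠ v, X w
    have hy : y ∉ P := by
      have hprime : P.IsPrime := inferInstance
      rw [hprime.prod_mem_iff]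
      rintro ⟨w, hw, hwP⟩
      rw [hP, X_mem_span_pair_iff] at hwP
      have := (Finset.mem_filter.1 hw).2
      tauto
    have hyJ : Ideal.span {y} * P ≤ coverIdeal k G := by
      refine le_iInf fun a => le_iInf fun b => le_iInf fun hab => ?_
      by_cases hc : (a = u ∨ a = v) ∧ (b = u ∨ b = v)
      · refine Ideal.mul_le_right.trans (hP.le.trans ?_)
        have hne := hab.ne
        rcases hc with ⟨rfl | rfl, rfl | rfl⟩
        · exact absurd rfl hne
        · exact le_rfl
        · rw [Set.pair_comm]
        · exact absurd rfl hne
      · refine Ideal.mul_le_left.trans ((Ideal.span_singleton_le_iff_mem _).2 ?_)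
        rw [not_and_or, not_or, not_or] at hc
        rcases hc with hc | hc
        · exact Ideal.mem_of_dvd _ (Finset.dvd_prod_of_mem _ (by simpa using hc))
            (Ideal.subset_span (Set.mem_insert _ _))
        · exact Ideal.mem_of_dvd _ (Finset.dvd_prod_of_mem _ (by simpa using hc))
            (Ideal.subset_span (Set.mem_insert_of_mem _ rfl))
    refine ⟨y ^ n, P.primeCompl.pow_mem hy n, Ideal.pow_right_mono hyJ n ?_⟩
    rw [mul_pow]
    refine Ideal.mul_mem_mul (Ideal.pow_mem_pow (Ideal.mem_span_singleton_self y) n) ?_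
    rw [hP]
    exact (mem_span_pair_pow_iff huv.ne).2 h

theorem mem_symbolicPower_coverIdeal_iff {n : ℕ} {f : MvPolynomial V k} :
    f ∈ symbolicPower (coverIdeal k G) n ↔ ∀ α ∈ f.support, G.IsMultiCover n α := by
  rw [symbolicPower, Ideal.mem_iInf]
  refine ⟨fun h α hα u v huv => ?_, fun h P => ?_⟩
  · have hP := (mem_minimalPrimes_coverIdeal_iff k G).2 ⟨u, v, huv, rfl⟩
    have := isPrime_of_minimalPrimes ⟨_, hP⟩
    exact (mem_localContraction_coverIdeal_pow_iff k G huv n _ rfl).1 (h ⟨_, hP⟩) α hα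
  · obtain ⟨u, v, huv, hP⟩ := (mem_minimalPrimes_coverIdeal_iff k G).1 P.2
    have := isPrime_of_minimalPrimes P
    exact (mem_localContraction_coverIdeal_pow_iff k G huv n _ hP).2 fun α hα => h α hα u v huv

theorem symbolicPower_coverIdeal_one : symbolicPower (coverIdeal k G) 1 = coverIdeal k G := by
  ext f
  rw [mem_symbolicPower_coverIdeal_iff, mem_coverIdeal_iff]

theorem minimalGens_symbolicPower_coverIdeal (n : ℕ) :
    minimalGens (symbolicPower (coverIdeal k G) n) = {α | Minimal (G.IsMultiCover n) α} := by
  classical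
  simp [minimalGens, mem_symbolicPower_coverIdeal_iff, support_monomial]

theorem minimalGens_coverIdeal :
    minimalGens (coverIdeal k G) = {α | Minimal (G.IsMultiCover 1) α} := by
  rw [← symbolicPower_coverIdeal_one, minimalGens_symbolicPower_coverIdeal]

end CoverIdeal

/-! ### Generator degrees of monomial ideals -/

section GenDegrees

variable {k : Type*} [Field k] {V : Type*}

/-- The degrees of the minimal homogeneous generators of a monomial ideal are those of its minimal
monomial generators. -/
theorem genDegrees_eq_image_degree {I : Ideal (MvPolynomial V k)} {C : (V →₀ ℕ) → Prop}
    (hI : ∀ f, f ∈ I ↔ ∀ α ∈ f.support, C α) :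
    genDegrees I = Finsupp.degree '' {α | Minimal C α} := by
  classical
  have hmon : ∀ α (c : k), C α → monomial α c ∈ I := fun α c h => (hI _).2 fun β hβ => by
    rwa [Finset.mem_singleton.1 (support_monomial_subset hβ)]
  have hmon' : ∀ α, monomial α (1 : k) ∈ I → C α := fun α h => (hI _).1 h α (by
    simp [support_monomial])
  have hup : ∀ α β, C α → α ≤ β → C β := fun α β h hle => by
    refine hmon' β ?_
    rw [← add_tsub_cancel_of_le hle, ← one_mul (1 : k), ← monomial_mul]
    exact I.mul_mem_right _ (hmon α 1 h)
  -- In a product `a * b` with `b ∈ I`, an exponent of `b` dividing the minimal `α` equals `α`,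
  -- which leaves the constant coefficient of `a`, and that is zero.
  have hmem : ∀ g ∈ Ideal.span (Set.range (X : V → MvPolynomial V k)) * I,
      ∀ α, Minimal C α → coeff α g = 0 := by
    intro g hg α hα
    refine Submodule.mul_induction_on hg (fun a ha b hb => ?_) fun a b ha hb => ?_
    · rw [coeff_mul]
      refine Finset.sum_eq_zero fun p hp => ?_
      rw [Finset.HasAntidiagonal.mem_antidiagonal] at hp
      by_cases hb0 : coeff p.2 b = 0
      · rw [hb0, mul_zero]
      · have hC := (hI b).1 hb p.2 (mem_support_iff.2 hb0)
        have hle : α ≤ p.2 := hα.le_of_le hC (hp ▸ le_add_self)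
        have hp1 : p.1 = 0 := by
          have : p.1 + p.2 ≤ 0 + p.2 := by rwa [hp, zero_add]
          exact le_antisymm (le_of_add_le_add_right this) zero_le
        rw [← Set.image_univ, mem_ideal_span_X_image] at ha
        have : coeff p.1 a = 0 := by
          by_contra hc
          obtain ⟨i, -, hi⟩ := ha _ (mem_support_iff.2 hc)
          exact hi (by simp [hp1])
        rw [this, zero_mul]
    · rw [coeff_add, ha, hb, add_zero]
  ext j
  constructor
  · rintro ⟨f, hf, hj, hnot⟩
    obtain ⟨α, hα, hαnot⟩ : ∃ α ∈ f.support,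
        monomial α (coeff α f) ∉ Ideal.span (Set.range (X : V → MvPolynomial V k)) * I := by
      by_contra! hc
      refine hnot ?_
      rw [f.as_sum]
      exact Ideal.sum_mem _ hc
    refine ⟨α, ⟨(hI f).1 hf α hα, fun β hβ hle => ?_⟩, ?_⟩
    -- If `α` were not minimal, a variable could be split off its term without leaving `I`, so the
    -- term would lie in `𝔪 I`.
    · by_contra hnle
      obtain ⟨i, hi⟩ : ∃ i, β i < α i := by
        by_contra! hc
        exact hnle hc
      have hs : Finsupp.single i 1 ≤ α := by
        rw [Finsupp.single_le_iff]
        omega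
      refine hαnot ?_
      rw [← add_tsub_cancel_of_le hs, ← one_mul (coeff _ f), ← monomial_mul]
      refine Ideal.mul_mem_mul (Ideal.subset_span ⟨i, rfl⟩) (hmon _ _ (hup β _ hβ fun l => ?_))
      have := hle l
      simp only [Finsupp.tsub_apply, Finsupp.single_apply]
      split_ifs with h
      · subst h; omega
      · omega
    · have := hj (mem_support_iff.1 hα)
      rwa [Finsupp.degree_eq_weight_one]
  · rintro ⟨α, hα, rfl⟩
    refine ⟨monomial α 1, hmon α 1 hα.prop, isHomogeneous_monomial _ rfl, fun hc => ?_⟩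
    simpa using hmem _ hc α hα

variable [Fintype V] (k) (G : SimpleGraph V)

theorem genDegrees_symbolicPower (n : ℕ) :
    genDegrees (symbolicPower (coverIdeal k G) n) =
      Finsupp.degree '' {α | Minimal (G.IsMultiCover n) α} :=
  genDegrees_eq_image_degree fun _ => mem_symbolicPower_coverIdeal_iff k G

theorem isGreatest_genDegrees_symbolicPower (n : ℕ) :
    IsGreatest (genDegrees (symbolicPower (coverIdeal k G) n))
      (maxGenDegree (symbolicPower (coverIdeal k G) n)) := by
  rw [maxGenDegree, genDegrees_symbolicPower]
  have hb := ((SimpleGraph.finite_minimal_isMultiCover G n).image Finsupp.degree).bddAbove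
  exact ⟨Nat.sSup_mem (Set.Nonempty.image _ (SimpleGraph.exists_minimal_isMultiCover G n)) hb,
    fun _ h => le_csSup hb h⟩

end GenDegrees

/-! ### Newton polyhedra of the edge primes -/

section NewtonPolyhedron

theorem convexHull_range_natCast :
    convexHull ℝ (Set.range ((↑) : ℕ → ℝ)) = Set.Ici (0 : ℝ) := by
  refine subset_antisymm (convexHull_min ?_ (convex_Ici (0 : ℝ))) fun x hx => ?_
  · rintro _ ⟨n, rfl⟩
    exact Set.mem_Ici.2 (Nat.cast_nonneg n)
  · obtain ⟨n, hn⟩ := exists_nat_ge x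
    have h0 : (0 : ℝ) ∈ convexHull ℝ (Set.range ((↑) : ℕ → ℝ)) :=
      subset_convexHull _ _ ⟨0, Nat.cast_zero⟩
    have hn' : (n : ℝ) ∈ convexHull ℝ (Set.range ((↑) : ℕ → ℝ)) :=
      subset_convexHull _ _ ⟨n, rfl⟩
    refine (convex_convexHull ℝ _).segment_subset h0 hn' ?_
    rw [segment_eq_Icc (Nat.cast_nonneg n)]
    exact ⟨hx, hn⟩

variable {k : Type*} [Field k] {V : Type*} [Fintype V]

theorem newtonPolyhedron_eq {u v : V} (huv : u ≠ v) {I : Ideal (MvPolynomial V k)}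
    (hI : ∀ α, monomial α (1 : k) ∈ I ↔ 1 ≤ α u + α v) :
    newtonPolyhedron I = {x | (∀ w, 0 ≤ x w) ∧ 1 ≤ x u + x v} := by
  classical
  refine subset_antisymm (convexHull_min ?_ ?_) fun x ⟨hx0, hx⟩ => ?_
  · rintro x ⟨α, hα, hx⟩
    refine ⟨fun w => by rw [hx]; exact Nat.cast_nonneg _, ?_⟩
    rw [hx, hx]
    exact_mod_cast (hI α).1 hα
  · rintro x ⟨hx0, hx⟩ y ⟨hy0, hy⟩ a b ha hb hab
    refine ⟨fun w => ?_, ?_⟩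
    · have := mul_nonneg ha (hx0 w)
      have := mul_nonneg hb (hy0 w)
      simp only [Pi.add_apply, Pi.smul_apply, smul_eq_mul]
      linarith
    · simp only [Pi.add_apply, Pi.smul_apply, smul_eq_mul]
      nlinarith [mul_le_mul_of_nonneg_left hx ha, mul_le_mul_of_nonneg_left hy hb]
  -- Convex hulls commute with sums and products, so the hull of `{e_u, e_v} + ℕ ^ V` is the segment
  -- plus the orthant.
  · have hsub : ({Pi.single u 1, Pi.single v 1} : Set (V → ℝ)) +
        Set.univ.pi (fun _ : V => Set.range ((↑) : ℕ → ℝ)) ⊆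
        {x | ∃ α : V →₀ ℕ, monomial α (1 : k) ∈ I ∧ ∀ v, x v = (α v : ℝ)} := by
      rintro _ ⟨y, hy, z, hz, rfl⟩
      choose β hβ using fun w => hz w (Set.mem_univ w)
      obtain ⟨a, ha, rfl⟩ : ∃ a, (a = u ∨ a = v) ∧ y = Pi.single a 1 := by
        rcases hy with rfl | rfl
        · exact ⟨u, Or.inl rfl, rfl⟩
        · exact ⟨v, Or.inr rfl, rfl⟩
      refine ⟨Finsupp.single a 1 + Finsupp.equivFunOnFinite.symm β, (hI _).2 ?_, fun w => ?_⟩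
      · rcases ha with rfl | rfl <;>
          simp only [Finsupp.add_apply, Finsupp.single_eq_same] <;> omega
      · simp [← hβ, Pi.single_apply, Finsupp.single_apply, eq_comm]
    refine convexHull_mono hsub ?_
    rw [convexHull_add, convexHull_pi, convexHull_pair, convexHull_range_natCast]
    have hpos : 0 < x u + x v := by linarith
    have hp : ∀ a, x a / (x u + x v) ≤ x a := fun a => div_le_self (hx0 a) hx
    -- Scaling `(x u, x v)` down to sum `1` gives a point of the segment below `x`, because `x u + x
    -- v ≥ 1`.
    refine ⟨(x u / (x u + x v)) • Pi.single u 1 + (x v / (x u + x v)) • Pi.single v 1,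
      ⟨_, _, div_nonneg (hx0 u) hpos.le, div_nonneg (hx0 v) hpos.le, ?_, rfl⟩,
      x - ((x u / (x u + x v)) • Pi.single u 1 + (x v / (x u + x v)) • Pi.single v 1),
      fun w _ => ?_, add_sub_cancel _ _⟩
    · rw [← add_div, div_self hpos.ne']
    · simp only [Set.mem_Ici, Pi.sub_apply, Pi.add_apply, Pi.smul_apply, smul_eq_mul, sub_nonneg]
      by_cases h1 : w = u
      · subst h1
        simpa [Pi.single_eq_of_ne huv] using hp w
      · by_cases h2 : w = v
        · subst h2
          simpa [Pi.single_eq_of_ne h1] using hp w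
        · simpa [Pi.single_eq_of_ne h1, Pi.single_eq_of_ne h2] using hx0 w

end NewtonPolyhedron

/-! ### The symbolic polyhedron as the polyhedron of fractional covers -/

namespace SimpleGraph

variable {V : Type*} (G : SimpleGraph V)

/-- The polyhedron of fractional vertex covers of a graph. -/
def coverPolyhedron : Set (V → ℝ) :=
  {x | (∀ v, 0 ≤ x v) ∧ ∀ u v, G.Adj u v → 1 ≤ x u + x v}

end SimpleGraph

section Symbolic

variable (k : Type*) [Field k] {V : Type*} [Fintype V] {G : SimpleGraph V}

theorem symbolicPolyhedron_coverIdeal (hG : ∀ v, ¬ G.IsIsolated v) :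
    symbolicPolyhedron (coverIdeal k G) = G.coverPolyhedron := by
  classical
  have key : ∀ (u v : V), G.Adj u v → ∀ (P : Ideal (MvPolynomial V k)) [P.IsPrime],
      P = Ideal.span {X u, X v} → newtonPolyhedron (localContraction (coverIdeal k G) P) =
        {x | (∀ w, 0 ≤ x w) ∧ 1 ≤ x u + x v} := fun u v huv P _ hP => by
    refine newtonPolyhedron_eq huv.ne fun α => ?_
    have := mem_localContraction_coverIdeal_pow_iff k G huv 1 P hP (f := monomial α 1)
    rw [pow_one] at this
    simp [this, support_monomial]
  ext x
  rw [symbolicPolyhedron, Set.mem_iInter]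
  refine ⟨fun h => ?_, fun h P => ?_⟩
  · have hx : ∀ u v, G.Adj u v → (∀ w, 0 ≤ x w) ∧ 1 ≤ x u + x v := fun u v huv => by
      have hP := (mem_minimalPrimes_coverIdeal_iff k G).2 ⟨u, v, huv, rfl⟩
      have := isPrime_of_minimalPrimes ⟨_, hP⟩
      have hx := h ⟨_, hP⟩
      rwa [key u v huv _ rfl] at hx
    refine ⟨fun v => ?_, fun u v huv => (hx u v huv).2⟩
    -- Any one of the Newton polyhedra gives nonnegativity; the edge at `v` ensures that there is
    -- one.
    obtain ⟨u, hu⟩ : ∃ u, G.Adj v u := by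
      by_contra! hc
      exact hG v hc
    exact (hx v u hu).1 v
  · obtain ⟨u, v, huv, hP⟩ := (mem_minimalPrimes_coverIdeal_iff k G).1 P.2
    have := isPrime_of_minimalPrimes P
    rw [key u v huv _ hP]
    exact ⟨h.1, h.2 u v huv⟩

end Symbolic

/-! ### Half-integrality of vertices, and vertices from minimal `2`-covers -/

namespace SimpleGraph

variable {V : Type*} {G : SimpleGraph V} {x d : V → ℝ}

open Filter Topology in
/-- At an extreme point no direction preserves all the tight constraints. -/
theorem eq_zero_of_mem_extremePoints_coverPolyhedron [Finite V]
    (hx : x ∈ G.coverPolyhedron.extremePoints ℝ) (hd : ∀ v, x v = 0 → d v = 0)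
    (hd' : ∀ u v, G.Adj u v → x u + x v = 1 → d u + d v = 0) : d = 0 := by
  -- A slack constraint survives a small move, and a tight one is unchanged in the direction `d`.
  have hstep : ∀ a b c : ℝ, c ≤ a → (a = c → b = 0) → ∀ᶠ ε in 𝓝 (0 : ℝ), c ≤ a + ε * b := by
    intro a b c hca hb
    rcases hca.eq_or_lt with h | h
    · simp [hb h.symm, h]
    · have hcont : Continuous fun ε : ℝ => a + ε * b := by fun_prop
      have : Tendsto (fun ε : ℝ => a + ε * b) (𝓝 0) (𝓝 (a + 0 * b)) := hcont.tendsto 0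
      rw [zero_mul, add_zero] at this
      exact (this.eventually (lt_mem_nhds h)).mono fun _ h => h.le
  have hmem : ∀ d : V → ℝ, (∀ v, x v = 0 → d v = 0) →
      (∀ u v, G.Adj u v → x u + x v = 1 → d u + d v = 0) →
      ∀ᶠ ε in 𝓝 (0 : ℝ), x + ε • d ∈ G.coverPolyhedron := by
    intro d hd hd'
    have h1 := eventually_all.2 fun v => hstep (x v) (d v) 0 (hx.1.1 v) (hd v)
    have h2 : ∀ᶠ ε in 𝓝 (0 : ℝ), ∀ u v, G.Adj u v → 1 ≤ x u + x v + ε * (d u + d v) := by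
      refine eventually_all.2 fun u => eventually_all.2 fun v => ?_
      by_cases huv : G.Adj u v
      · exact (hstep _ _ 1 (hx.1.2 u v huv) (hd' u v huv)).mono fun _ h _ => h
      · simp [huv]
    filter_upwards [h1, h2] with ε h1 h2
    refine ⟨fun v => by simpa using h1 v, fun u v huv => ?_⟩
    have := h2 u v huv
    simp only [Pi.add_apply, Pi.smul_apply, smul_eq_mul]
    linarith
  have h1 := hmem d hd hd'
  have h2 := hmem (-d) (fun v hv => by simp [hd v hv]) fun u v huv h => by
    have := hd' u v huv h
    simp only [Pi.neg_apply]
    linarith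
  have h3 : ∀ᶠ ε in 𝓝[>] (0 : ℝ), 0 < ε ∧ x + ε • d ∈ G.coverPolyhedron ∧
      x + ε • (-d) ∈ G.coverPolyhedron :=
    (eventually_mem_nhdsWithin).and ((h1.and h2).filter_mono nhdsWithin_le_nhds)
  obtain ⟨ε, hε, hp, hm⟩ := h3.exists
  have heq : x + ε • d = x := hx.2 hp hm
    ⟨1 / 2, 1 / 2, by norm_num, by norm_num, by norm_num, by
      ext v
      simp only [Pi.add_apply, Pi.smul_apply, Pi.neg_apply, smul_eq_mul]
      ring⟩
  have : ε • d = 0 := by simpa using heq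
  exact (smul_eq_zero.1 this).resolve_left hε.ne'

/-- Otherwise the coordinate at `v` could be moved alone without affecting a tight constraint. -/
theorem exists_tight_of_mem_extremePoints_coverPolyhedron [Finite V]
    (hx : x ∈ G.coverPolyhedron.extremePoints ℝ) {v : V} (hv : x v ≠ 0) :
    ∃ u, G.Adj v u ∧ x v + x u = 1 := by
  classical
  by_contra! hc
  have := eq_zero_of_mem_extremePoints_coverPolyhedron hx (d := Pi.single v 1)
    (fun w hw => Pi.single_eq_of_ne (by rintro rfl; exact hv hw) _) fun a b hab h => by
      have ha : a ≠ v := by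
        rintro rfl
        exact hc b hab h
      have hb : b ≠ v := by
        rintro rfl
        exact hc a hab.symm (by rwa [add_comm])
      simp [Pi.single_eq_of_ne ha, Pi.single_eq_of_ne hb]
  simpa using congrFun this v

/-- The extreme points of the polyhedron of fractional vertex covers are half-integral. -/
theorem eq_of_mem_extremePoints_coverPolyhedron [Finite V]
    (hx : x ∈ G.coverPolyhedron.extremePoints ℝ) (v : V) :
    x v = 0 ∨ x v = 1 / 2 ∨ x v = 1 := by
  classical
  -- Tight edges pair a value `t` with `1 - t`, so raising the values below `1 / 2` and lowering
  -- those above preserves tightness.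
  let d : V → ℝ := fun w =>
    if x w = 0 ∨ x w = 1 / 2 ∨ x w = 1 then 0 else if x w < 1 / 2 then 1 else -1
  have hd : d = 0 := by
    refine eq_zero_of_mem_extremePoints_coverPolyhedron hx (fun w hw => by simp [d, hw])
      fun a b hab h => ?_
    have hb : x b = 1 - x a := by linarith
    by_cases ha : x a = 0 ∨ x a = 1 / 2 ∨ x a = 1
    · have hb' : x b = 0 ∨ x b = 1 / 2 ∨ x b = 1 := by
        rcases ha with ha | ha | ha <;> rw [ha] at hb <;> norm_num at hb
        · exact Or.inr (Or.inr hb)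
        · exact Or.inr (Or.inl hb)
        · exact Or.inl hb
      simp only [d, if_pos ha, if_pos hb', add_zero]
    · have hb' : ¬ (x b = 0 ∨ x b = 1 / 2 ∨ x b = 1) := by
        intro hb'
        refine ha ?_
        rcases hb' with hb' | hb' | hb'
        · exact Or.inr (Or.inr (by linarith))
        · exact Or.inr (Or.inl (by linarith))
        · exact Or.inl (by linarith)
      simp only [d, if_neg ha, if_neg hb']
      push Not at ha
      by_cases hlt : x a < 1 / 2
      · rw [if_pos hlt, if_neg (by linarith)]
        norm_num
      · have : x b < 1 / 2 := by
          have := lt_of_le_of_ne (not_lt.1 hlt) (Ne.symm ha.2.1)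
          linarith
        rw [if_neg hlt, if_pos this]
        norm_num
  by_contra hc
  have := congrFun hd v
  simp only [d, if_neg hc, Pi.zero_apply] at this
  split_ifs at this <;> norm_num at this

/-- Doubling clears the half-integers and keeps tight edges. Not every minimal `2`-cover arises so:
the constant `1` on a single edge does not. -/
theorem exists_minimal_two_of_mem_extremePoints [Finite V]
    (hx : x ∈ G.coverPolyhedron.extremePoints ℝ) :
    ∃ α : V →₀ ℕ, Minimal (G.IsMultiCover 2) α ∧ ∀ v, (α v : ℝ) = 2 * x v := by
  have hint : ∀ v, ∃ a : ℕ, (a : ℝ) = 2 * x v := fun v => by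
    rcases eq_of_mem_extremePoints_coverPolyhedron hx v with h | h | h
    · exact ⟨0, by simp [h]⟩
    · exact ⟨1, by simp [h]⟩
    · exact ⟨2, by simp [h]⟩
  choose a ha using hint
  refine ⟨Finsupp.equivFunOnFinite.symm a, minimal_isMultiCover_iff.2 ⟨fun u v huv => ?_,
    fun v hv => ?_⟩, ha⟩
  · have h1 := hx.1.2 u v huv
    have : (2 : ℝ) ≤ a u + a v := by
      rw [ha, ha]
      linarith
    exact_mod_cast this
  · have hv' : x v ≠ 0 := fun h0 => hv (by
      have := ha v
      rw [h0, mul_zero] at this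
      exact_mod_cast this)
    obtain ⟨u, hu, he⟩ := exists_tight_of_mem_extremePoints_coverPolyhedron hx hv'
    refine ⟨u, hu, ?_⟩
    have : (a v : ℝ) + a u = 2 := by
      rw [ha, ha]
      linarith
    exact_mod_cast this

/-- Some extreme point has at least half the degree of a given minimal `2`-cover: maximize the
coordinate sum over the face of the polyhedron on which the cover lies. -/
theorem exists_mem_extremePoints_of_minimal_two [Fintype V] {α : V →₀ ℕ}
    (hα : Minimal (G.IsMultiCover 2) α) :
    ∃ x ∈ G.coverPolyhedron.extremePoints ℝ, (α.degree : ℝ) ≤ 2 * ∑ v, x v := by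
  obtain ⟨hc, ht⟩ := minimal_isMultiCover_iff.1 hα
  -- The face where all constraints tight at `α / 2` are equalities. It is bounded since each vertex
  -- of the support of `α` lies on a tight edge.
  let F : Set (V → ℝ) := {x | x ∈ G.coverPolyhedron ∧ (∀ v, α v = 0 → x v = 0) ∧
    ∀ u v, G.Adj u v → α u + α v = 2 → x u + x v = 1}
  have hclosed : IsClosed F := by
    have : F = (⋂ v, {x | 0 ≤ x v}) ∩ (⋂ u, ⋂ v, ⋂ _ : G.Adj u v, {x | 1 ≤ x u + x v}) ∩
        (⋂ v, ⋂ _ : α v = 0, {x | x v = 0}) ∩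
        (⋂ u, ⋂ v, ⋂ _ : G.Adj u v, ⋂ _ : α u + α v = 2, {x | x u + x v = 1}) := by
      ext x
      simp only [F, coverPolyhedron, Set.mem_inter_iff, Set.mem_iInter, Set.mem_ofPred_eq, and_assoc]
    rw [this]
    refine ((IsClosed.inter ?_ ?_).inter ?_).inter ?_
    · exact isClosed_iInter fun v => isClosed_le (by fun_prop) (by fun_prop)
    · exact isClosed_iInter fun u => isClosed_iInter fun v => isClosed_iInter fun _ =>
        isClosed_le (by fun_prop) (by fun_prop)
    · exact isClosed_iInter fun v => isClosed_iInter fun _ =>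
        isClosed_eq (by fun_prop) (by fun_prop)
    · exact isClosed_iInter fun u => isClosed_iInter fun v => isClosed_iInter fun _ =>
        isClosed_iInter fun _ => isClosed_eq (by fun_prop) (by fun_prop)
  have hcompact : IsCompact F := by
    refine (isCompact_Icc (a := (0 : V → ℝ)) (b := 1)).of_isClosed_subset hclosed
      fun x hx => ⟨hx.1.1, fun v => ?_⟩
    by_cases hv : α v = 0
    · simp [hx.2.1 v hv]
    · obtain ⟨u, hu, he⟩ := ht v hv
      have h1 := hx.2.2 v u hu he
      have h2 := hx.1.1 u
      simp only [Pi.one_apply]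
      linarith
  have hmem : (fun v => (α v : ℝ) / 2) ∈ F := by
    refine ⟨⟨fun v => by positivity, fun u v huv => ?_⟩, fun v hv => by simp [hv],
      fun u v _ he => ?_⟩
    · have : (2 : ℝ) ≤ α u + α v := by exact_mod_cast hc u v huv
      linarith
    · have : (α u : ℝ) + α v = 2 := by exact_mod_cast he
      linarith
  have hcont : Continuous fun x : V → ℝ => ∑ v, x v := by fun_prop
  obtain ⟨y, hyF, hy⟩ := hcompact.exists_isMaxOn ⟨_, hmem⟩ hcont.continuousOn
  let M : Set (V → ℝ) := F ∩ {x | ∑ v, x v = ∑ v, y v}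
  have hM : IsCompact M := hcompact.inter_right (isClosed_eq hcont continuous_const)
  obtain ⟨z, hz⟩ := hM.extremePoints_nonempty ⟨y, hyF, rfl⟩
  -- `M` is a face of the face `F`: slacks are nonnegative, so if a positive combination of them
  -- vanishes, each one does.
  have hext : IsExtreme ℝ G.coverPolyhedron M := by
    have hF : ∀ p ∈ G.coverPolyhedron, ∀ q ∈ G.coverPolyhedron, ∀ w ∈ M,
        w ∈ openSegment ℝ p q → p ∈ F := by
      rintro p hp q hq w hw ⟨a, b, ha, hb, hab, rfl⟩
      refine ⟨hp, fun v hv => ?_, fun u v huv he => ?_⟩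
      · have h0 := hw.1.2.1 v hv
        simp only [Pi.add_apply, Pi.smul_apply, smul_eq_mul] at h0
        have h1 := mul_nonneg hb.le (hq.1 v)
        have h2 := mul_nonneg ha.le (hp.1 v)
        exact (mul_eq_zero.1 (by linarith : a * p v = 0)).resolve_left ha.ne'
      · have h0 := hw.1.2.2 u v huv he
        simp only [Pi.add_apply, Pi.smul_apply, smul_eq_mul] at h0
        have h1 := mul_nonneg hb.le (sub_nonneg.2 (hq.2 u v huv))
        have h2 := mul_nonneg ha.le (sub_nonneg.2 (hp.2 u v huv))
        have h3 : a * (p u + p v - 1) = 0 := by linarith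
        have := (mul_eq_zero.1 h3).resolve_left ha.ne'
        linarith
    refine ⟨fun w hw => hw.1.1, fun p hp q hq w hw hseg => ?_⟩
    have hpF := hF p hp q hq w hw hseg
    have hqF := hF q hq p hp w hw (by rwa [openSegment_symm])
    refine ⟨hpF, ?_⟩
    obtain ⟨a, b, ha, hb, hab, rfl⟩ := hseg
    have h0 : ∑ v, (a • p + b • q) v = ∑ v, y v := hw.2
    simp only [Pi.add_apply, Pi.smul_apply, smul_eq_mul, Finset.sum_add_distrib,
      ← Finset.mul_sum] at h0
    have h1 : ∑ v, p v ≤ ∑ v, y v := hy hpF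
    have h2 : ∑ v, q v ≤ ∑ v, y v := hy hqF
    have h3 := mul_nonneg hb.le (sub_nonneg.2 h2)
    have h4 := mul_nonneg ha.le (sub_nonneg.2 h1)
    have h5 : a * (∑ v, y v - ∑ v, p v) = 0 := by
      have : (a + b) * ∑ v, y v = ∑ v, y v := by rw [hab, one_mul]
      linarith
    have := (mul_eq_zero.1 h5).resolve_left ha.ne'
    exact (by linarith : ∑ v, p v = ∑ v, y v)
  refine ⟨z, hext.extremePoints_subset_extremePoints hz, ?_⟩
  have h1 : ∑ v, z v = ∑ v, y v := hz.1.2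
  have h2 : ∑ v, (α v : ℝ) / 2 ≤ ∑ v, y v := hy hmem
  rw [Finsupp.degree_eq_sum, h1]
  push_cast
  rw [← Finset.sum_div] at h2
  linarith

end SimpleGraph

/-! ### The identity `2 δ(J) = d(J^(2))` -/

section Delta

variable (k : Type*) [Field k] {V : Type*} [Fintype V] {G : SimpleGraph V}

theorem isGreatest_vertexSums_coverIdeal (hG : ∀ v, ¬ G.IsIsolated v) :
    IsGreatest (vertexSums (coverIdeal k G))
      ((maxGenDegree (symbolicPower (coverIdeal k G) 2) : ℝ) / 2) := by
  have hgr := isGreatest_genDegrees_symbolicPower k G 2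
  rw [genDegrees_symbolicPower] at hgr
  obtain ⟨⟨α, hα, hdeg⟩, hub⟩ := hgr
  rw [vertexSums, symbolicPolyhedron_coverIdeal k hG]
  have hle : ∀ x ∈ G.coverPolyhedron.extremePoints ℝ,
      ∑ v, x v ≤ (maxGenDegree (symbolicPower (coverIdeal k G) 2) : ℝ) / 2 := by
    intro x hx
    obtain ⟨β, hβ, hβx⟩ := SimpleGraph.exists_minimal_two_of_mem_extremePoints hx
    have h1 : (β.degree : ℝ) ≤ maxGenDegree (symbolicPower (coverIdeal k G) 2) := by
      exact_mod_cast hub ⟨β, hβ, rfl⟩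
    rw [Finsupp.degree_eq_sum] at h1
    push_cast at h1
    simp only [hβx, ← Finset.mul_sum] at h1
    linarith
  refine ⟨?_, ?_⟩
  · obtain ⟨x, hx, hx'⟩ := SimpleGraph.exists_mem_extremePoints_of_minimal_two hα
    refine ⟨x, hx, le_antisymm (hle x hx) ?_⟩
    rw [← hdeg]
    linarith
  · rintro _ ⟨x, hx, rfl⟩
    exact hle x hx

theorem two_mul_delta_coverIdeal (hG : ∀ v, ¬ G.IsIsolated v) :
    2 * delta (coverIdeal k G) = maxGenDegree (symbolicPower (coverIdeal k G) 2) := by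
  rw [delta, (isGreatest_vertexSums_coverIdeal k hG).csSup_eq]
  ring

end Delta

end

/-! ### Degrees of the even and odd symbolic powers -/

section Complementary

variable (k : Type*) [Field k] {V : Type*} [Fintype V] {G : SimpleGraph V}

theorem complementaryDegrees_coverIdeal (hG : ∀ v, ¬ G.IsIsolated v) :
    complementaryDegrees (coverIdeal k G) =
      {e | ∃ β, Minimal (G.IsMultiCover 1) β ∧ β.degree = e ∧ ∃ α, Minimal (G.IsMultiCover 2) α ∧
        α.degree = maxGenDegree (symbolicPower (coverIdeal k G) 2) ∧
        Minimal (G.IsMultiCover 3) (α + β)} := by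
  simp only [complementaryDegrees, minimalGens_coverIdeal, minimalGens_symbolicPower_coverIdeal,
    two_mul_delta_coverIdeal k hG, Set.mem_ofPred_eq, Nat.cast_inj]

theorem degree_le_maxGenDegree {n : ℕ} {α : V →₀ ℕ} (h : Minimal (G.IsMultiCover n) α) :
    α.degree ≤ maxGenDegree (symbolicPower (coverIdeal k G) n) := by
  have := isGreatest_genDegrees_symbolicPower k G n
  rw [genDegrees_symbolicPower] at this
  exact this.2 ⟨α, h, rfl⟩

variable (G) in
theorem exists_degree_eq_maxGenDegree (n : ℕ) : ∃ α, Minimal (G.IsMultiCover n) α ∧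
    α.degree = maxGenDegree (symbolicPower (coverIdeal k G) n) := by
  have := isGreatest_genDegrees_symbolicPower k G n
  rw [genDegrees_symbolicPower] at this
  exact this.1

/-- Completing a `2`-cover of maximal degree to a minimal `3`-cover shows that the set is nonempty.
-/
theorem exists_isGreatest_complementaryDegrees (hG : ∀ v, ¬ G.IsIsolated v) :
    ∃ e, IsGreatest (complementaryDegrees (coverIdeal k G)) e ∧
      e ≤ maxGenDegree (symbolicPower (coverIdeal k G) 1) := by
  have hub : ∀ e ∈ complementaryDegrees (coverIdeal k G),
      e ≤ maxGenDegree (symbolicPower (coverIdeal k G) 1) := by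
    rw [complementaryDegrees_coverIdeal k hG]
    rintro _ ⟨β, hβ, rfl, -⟩
    exact degree_le_maxGenDegree k hβ
  have hne : (complementaryDegrees (coverIdeal k G)).Nonempty := by
    rw [complementaryDegrees_coverIdeal k hG]
    obtain ⟨α, hα, hdeg⟩ := exists_degree_eq_maxGenDegree k G 2
    obtain ⟨β, hβ, h3⟩ := SimpleGraph.exists_minimal_add_of_minimal_two hα
    exact ⟨β.degree, β, hβ, rfl, α, hα, hdeg, h3⟩
  have hmem := Nat.sSup_mem hne ⟨_, hub⟩
  exact ⟨_, ⟨hmem, fun _ h => le_csSup ⟨_, hub⟩ h⟩, hub _ hmem⟩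

theorem maxGenDegree_symbolicPower_even (s : ℕ) :
    maxGenDegree (symbolicPower (coverIdeal k G) (2 * s)) =
      s * maxGenDegree (symbolicPower (coverIdeal k G) 2) := by
  obtain ⟨α, hα, hdeg⟩ := exists_degree_eq_maxGenDegree k G (2 * s)
  obtain ⟨β, hβ, hdeg'⟩ := exists_degree_eq_maxGenDegree k G 2
  refine le_antisymm ?_ ?_
  · rw [← hdeg]
    exact SimpleGraph.degree_le_of_minimal_isMultiCover_even
      (fun _ h => degree_le_maxGenDegree k h) s hα
  · have h := SimpleGraph.minimal_isMultiCover_nsmul_add s hβ.prop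
      SimpleGraph.minimal_isMultiCover_zero.prop (by simpa using hβ)
      SimpleGraph.minimal_isMultiCover_zero
    rw [add_zero, add_zero, mul_comm] at h
    have := degree_le_maxGenDegree k h
    rwa [map_nsmul, smul_eq_mul, hdeg'] at this

/-- The bound is attained by `s • α + β` with `α + β` a `3`-cover realizing `e`. The condition `hs`
makes the second alternative of the upper bound no larger. -/
theorem maxGenDegree_symbolicPower_odd (hG : ∀ v, ¬ G.IsIsolated v) {e : ℕ}
    (he : IsGreatest (complementaryDegrees (coverIdeal k G)) e) {s : ℕ}
    (hs : maxGenDegree (symbolicPower (coverIdeal k G) 1) ≤ e + s) :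
    maxGenDegree (symbolicPower (coverIdeal k G) (2 * s + 1)) =
      s * maxGenDegree (symbolicPower (coverIdeal k G) 2) + e := by
  rw [complementaryDegrees_coverIdeal k hG] at he
  obtain ⟨⟨β, hβ, hβe, α, hα, hαd, h3⟩, hub⟩ := he
  refine le_antisymm ?_ ?_
  · obtain ⟨γ, hγ, hdeg⟩ := exists_degree_eq_maxGenDegree k G (2 * s + 1)
    rw [← hdeg]
    rcases SimpleGraph.degree_le_of_minimal_isMultiCover_odd
      (fun _ h => degree_le_maxGenDegree k h) (fun _ h => degree_le_maxGenDegree k h)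
      (fun α β hα hβ h3 hd => hub ⟨β, hβ, rfl, α, hα, hd, h3⟩) s hγ with h | h
    · exact h
    · omega
  · have h := degree_le_maxGenDegree k
      (SimpleGraph.minimal_isMultiCover_nsmul_add s hα.prop hβ.prop h3 hβ)
    rwa [map_add, map_nsmul, smul_eq_mul, hαd, hβe, mul_comm s 2] at h

/-- The constant function `1` is a minimal `2`-cover, and its sum with a minimal cover is a minimal
`3`-cover. -/
theorem minimal_isMultiCover_const_add (hG : ∀ v, ¬ G.IsIsolated v) {β : V →₀ ℕ}
    (hβ : Minimal (G.IsMultiCover 1) β) :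
    Minimal (G.IsMultiCover 2) (Finsupp.equivFunOnFinite.symm fun _ => 1) ∧
      Minimal (G.IsMultiCover 3) ((Finsupp.equivFunOnFinite.symm fun _ => 1) + β) := by
  have h2 : G.IsMultiCover 2 (Finsupp.equivFunOnFinite.symm fun _ => 1) := fun u v _ => by simp
  have h3 : Minimal (G.IsMultiCover 3) ((Finsupp.equivFunOnFinite.symm fun _ => 1) + β) := by
    refine SimpleGraph.minimal_isMultiCover_iff.2 ⟨h2.add hβ.prop, fun v _ => ?_⟩
    simp only [Finsupp.add_apply, Finsupp.equivFunOnFinite_symm_apply_apply]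
    by_cases hv : β v = 0
    · obtain ⟨u, hu⟩ : ∃ u, G.Adj v u := by
        by_contra! hc
        exact hG v hc
      have h4 := hβ.prop v u hu
      have h5 := SimpleGraph.le_of_minimal_isMultiCover hβ u
      exact ⟨u, hu, by omega⟩
    · obtain ⟨u, hu, he⟩ := (SimpleGraph.minimal_isMultiCover_iff.1 hβ).2 v hv
      exact ⟨u, hu, by omega⟩
  exact ⟨SimpleGraph.minimal_isMultiCover_of_add h2 hβ.prop h3, h3⟩

/-- A minimal `1`-cover `β` of maximal degree is completed by `2 • β` in the first case, and by the
constant `1`, of degree `r`, in the second. -/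
theorem maxGenDegree_mem_complementaryDegrees (hG : ∀ v, ¬ G.IsIsolated v)
    (h : maxGenDegree (symbolicPower (coverIdeal k G) 2) =
        2 * maxGenDegree (symbolicPower (coverIdeal k G) 1) ∨
      maxGenDegree (symbolicPower (coverIdeal k G) 2) = Fintype.card V) :
    maxGenDegree (symbolicPower (coverIdeal k G) 1) ∈ complementaryDegrees (coverIdeal k G) := by
  rw [complementaryDegrees_coverIdeal k hG]
  obtain ⟨β, hβ, hdeg⟩ := exists_degree_eq_maxGenDegree k G 1
  refine ⟨β, hβ, hdeg, ?_⟩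
  rcases h with h | h
  · have hmul : ∀ s, Minimal (G.IsMultiCover s) (s • β) := fun s => by
      simpa using SimpleGraph.minimal_isMultiCover_nsmul_add s hβ.prop
        SimpleGraph.minimal_isMultiCover_zero.prop (by simpa using hβ)
        SimpleGraph.minimal_isMultiCover_zero
    refine ⟨2 • β, hmul 2, by rw [map_nsmul, hdeg, h, smul_eq_mul], ?_⟩
    rw [← succ_nsmul]
    exact hmul 3
  · obtain ⟨h2, h3⟩ := minimal_isMultiCover_const_add hG hβ
    exact ⟨_, h2, by simp [h, Finsupp.degree_eq_sum], h3⟩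

end Complementary

theorem theorem4p10 (k : Type*) [Field k] {V : Type*} [Fintype V] (G : SimpleGraph V)
    (hG : ∀ v, ¬ G.IsIsolated v) (J : Ideal (MvPolynomial V k)) (hJ : J = coverIdeal k G) :
    -- the maxima in the definitions of `δ(J)`, `d(J)` and `d(J^(n))` exist
    IsGreatest (vertexSums J) (delta J) ∧
    IsGreatest (genDegrees J) (maxGenDegree J) ∧
    (∀ n : ℕ, IsGreatest (genDegrees (symbolicPower J n)) (maxGenDegree (symbolicPower J n))) ∧
    -- even symbolic powers
    (∀ s : ℕ, 1 ≤ s → (maxGenDegree (symbolicPower J (2 * s)) : ℝ) = delta J * (2 * s)) ∧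
    -- odd symbolic powers
    ∃ e : ℕ, IsGreatest (complementaryDegrees J) e ∧
      (∀ s : ℕ, (maxGenDegree J : ℤ) - e ≤ s →
        (maxGenDegree (symbolicPower J (2 * s + 1)) : ℝ) = delta J * (2 * s) + e) ∧
      (delta J = maxGenDegree J ∨ delta J = (Fintype.card V : ℝ) / 2 →
        e = maxGenDegree J ∧
        ∀ s : ℕ, (maxGenDegree (symbolicPower J (2 * s + 1)) : ℝ) =
          delta J * (2 * s) + maxGenDegree J) := by
  subst hJ
  have hδ := two_mul_delta_coverIdeal k hG
  have h1 := symbolicPower_coverIdeal_one k G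
  obtain ⟨e, he, hle⟩ := exists_isGreatest_complementaryDegrees k hG
  have hodd : ∀ s : ℕ, (maxGenDegree (coverIdeal k G) : ℤ) - e ≤ s →
      (maxGenDegree (symbolicPower (coverIdeal k G) (2 * s + 1)) : ℝ) =
        delta (coverIdeal k G) * (2 * s) + e := fun s hs => by
    rw [maxGenDegree_symbolicPower_odd k hG he (by rw [h1]; omega)]
    push_cast
    rw [← hδ]
    ring
  refine ⟨?_, ?_, isGreatest_genDegrees_symbolicPower k G, fun s _ => ?_, e, he, hodd, fun h => ?_⟩
  · rw [delta, (isGreatest_vertexSums_coverIdeal k hG).csSup_eq]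
    exact isGreatest_vertexSums_coverIdeal k hG
  · simpa only [h1] using isGreatest_genDegrees_symbolicPower k G 1
  · rw [maxGenDegree_symbolicPower_even]
    push_cast
    rw [← hδ]
    ring
  · have hmem := he.2 (maxGenDegree_mem_complementaryDegrees k hG (by
      rw [h1]
      refine h.imp (fun h => ?_) fun h => ?_
      · rw [h] at hδ
        exact_mod_cast hδ.symm
      · rw [h, mul_div_cancel₀ _ two_ne_zero] at hδ
        exact_mod_cast hδ.symm))
    have heq : e = maxGenDegree (coverIdeal k G) := by
      rw [h1] at hle hmem
      exact le_antisymm hle hmem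
    -- With `e = d(J)` the threshold on `s` is zero.
    exact ⟨heq, fun s => by rw [hodd s (by omega), heq]⟩
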